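/- **Proposition 4.3 (number of superimpositions, different lengths).** For integers $1\le c\le n$ with $\gcd(n,c)=1$, let $C(n,c)\in\{a<x\}^n$ be the Christoffel word of length $n$ with $c$ occurrences of $a$: for $0\le i<n$ its letter at position $i$ is $a$ if $(i+1)(n-c) \bmod n> i(n-c)\bmod n$, and $x$ otherwise (and $C(1,1)=a$). The same notation with the letter $b$ in place of $a$ is used for words over $\{b<x\}$. For words $u\in\{a,x\}^n$ and $v\in\{b,x\}^m$, let $A$ be the set of positions of the $a$'s in $u$ and $B$ the set of positions of the $b$'s in $v$. The words $u,v$ are *superimposable* if $(A+n\mathbb Z)\cap(B-k+m\mathbb Z)=\emptyset$ for some $k\in\mathbb Z$, and *perfectly superimposable* if this holds for $k=0$. Let $\gamma$ be the conjugacy operator, which moves the first letter of a word to its end. The *number of superimpositions* of $u$ and $v$ is the number of $k\in\{0,\dots,m-1\}$ such that $u$ and $\gamma^k(v)$ are perfectly superimposable. Let $n,m,q,\alpha,\beta$ be positive integers with $\gcd(\alpha,\beta)=1$, $q\alpha\le n$, $q\beta\le m$, $\gcd(n,q\alpha)=1$, $\gcd(m,q\beta)=1$ and $n<m$, and let $p=\gcd(m,n)$.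 Suppose that the Christoffel words $C(n,q\alpha)\in\{a<x\}^n$ and $C(m,q\beta)\in\{b<x\}^m$ are superimposable. Then the equation $$x\alpha+y\beta=p-2\alpha\beta(q-1)$$ has a unique solution $(x,y)$ in positive integers with $y\le\alpha$, and for this solution the number of superimpositions of $C(n,q\alpha)$ and $C(m,q\beta)$ is 1. $\displaystyle xy\,\frac{m}{p}$, if $x\le\beta$; 2. $\displaystyle (x\alpha+y\beta-\alpha\beta)\,\frac{m}{p}$, if $x>\beta$. -/

import Mathlib

namespace Christoffel

/-- The letters: `a` and `x` for the first word, `b` and `x` for the second one. -/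
inductive Letter where
  | a : Letter
  | b : Letter
  | x : Letter

/-- The Christoffel word over `{c < z}` with `α` occurrences of `c` and `β` occurrences of `z`
(for coprime `α`, `β`), i.e. of slope `β / α`: with `n = α + β`, its letter at position `i < n` is
`c` if `(i + 1) β mod n > i β mod n`, and `z` otherwise.  The word of slope `0 / 1` is `c`
(the remainders modulo `1` cannot see this degenerate case). -/
def christoffelWord {A : Type*} (c z : A) (α β : ℕ) : List A :=
  (List.range (α + β)).map fun i =>
    if β = 0 ∨ (i * β) % (α + β) < ((i + 1) * β) % (α + β) then c else z

/-- The word `C(n, α)` over `{c < z}`, for `α ≤ n`: with `r = gcd(n, α)`, it is the `r`-th power of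
the Christoffel word of length `n / r` with `α / r` occurrences of `c`.  It is a Christoffel word
itself exactly when `n` and `α` are coprime. -/
def C {A : Type*} (c z : A) (n α : ℕ) : List A :=
  (List.replicate (n.gcd α)
    (christoffelWord c z (α / n.gcd α) ((n - α) / n.gcd α))).flatten

/-- The set `P + |u| ℤ`, where `P` is the set of positions (counted from `0`) of the letter `c` in
the finite word `u`: the positions of `c` in the bi-infinite periodic word `^ω u ^ω`. -/
def periodicPositions {A : Type*} (c : A) (u : List A) : Set ℤ :=
  {j | ∃ (i : ℕ) (t : ℤ), u[i]? = some c ∧ j = (i : ℤ) + (u.length : ℤ) * t}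

/-- `u` (over `{a, x}`) and `v` (over `{b, x}`) are superimposable: for some shift `k ∈ ℤ`,
`(A + |u| ℤ) ∩ (B - k + |v| ℤ) = ∅`, where `A` and `B` are the sets of positions of the `a`'s in `u`
and of the `b`'s in `v`. -/
def Superimposable (u v : List Letter) : Prop :=
  ∃ k : ℤ, periodicPositions Letter.a u ∩
    {j | ∃ i ∈ periodicPositions Letter.b v, j = i - k} = ∅

/-- `u` and `v` are perfectly superimposable: superimposable with the shift `k = 0`. -/
def PerfectlySuperimposable (u v : List Letter) : Prop :=
  periodicPositions Letter.a u ∩ periodicPositions Letter.b v = ∅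

/-- The number of superimpositions of `u` and `v`: the number of shifts `k`, with `0 ≤ k < |v|`,
such that `u` and the conjugate `γ ^ k v` are perfectly superimposable.  The conjugacy operator `γ`
moves the first letter of a word to its end, so `γ ^ k v` is `v.rotate k`. -/
noncomputable def numSuperimpositions (u v : List Letter) : ℕ :=
  Set.ncard {k : ℕ | k < v.length ∧ PerfectlySuperimposable u (v.rotate k)}

end Christoffel

namespace Christoffel

/-! Write `p = gcd(m, n)`. An `a` sits at `i` iff `i q α ≡ -r (mod n)` with `0 ≤ r < q α`, and a `b`
of the shifted word iff `(i + k) q β ≡ -s (mod m)` with `0 ≤ s < q β`. By the Chinese remainder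
theorem, they collide for some `i` iff an affine function of `k`, invertible modulo `p`, hits a
value `β r + α s` of a `q α × q β` rectangle. Trading `α` units of `r` for `β` units of `s` reshapes
it to `α × h`, with `h = (2q - 1) β`. So the answer is `m / p` times the number of residues missed
by that rectangle (`numSuperimpositions_C`).

The missed residues are counted with the Apéry set of `p` in the semigroup generated by `α` and `β`,
which represents each class once. For `p = β y + α X`, where `X = x + 2 (q - 1) β`, its normal forms
fill an L: `s < X`, or `r < y` and `s < X + β`. Cutting at height `h = X + β - x` leaves a `y × x`
rectangle if `x ≤ β`; if `x > β`, the whole `α × h` rectangle lies in the L and `p - α h` residues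
are missed. -/

/-- The numerical semigroup generated by `α` and `β`, as a set of integers. -/
def semi (α β : ℤ) : Set ℤ := {z | ∃ r s : ℤ, 0 ≤ r ∧ 0 ≤ s ∧ z = β * r + α * s}

/-- The residues modulo `p` that are not of the form `β r + α s` with `0 ≤ r < α`, `0 ≤ s < h`. -/
def missed (p : ℕ) (α β h : ℤ) : Set (ZMod p) :=
  {t | ∀ r s : ℤ, 0 ≤ r → r < α → 0 ≤ s → s < h → ((β * r + α * s : ℤ) : ZMod p) ≠ t}

/-! ### The semigroup of two coprime generators -/

theorem semi_add {α β z w : ℤ} (hz : z ∈ semi α β) (hw : w ∈ semi α β) : z + w ∈ semi α β := by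
  obtain ⟨r, s, hr, hs, rfl⟩ := hz
  obtain ⟨r', s', hr', hs', rfl⟩ := hw
  exact ⟨r + r', s + s', by omega, by omega, by ring⟩

theorem semi_add_mul {α β z w k : ℤ} (hz : z ∈ semi α β) (hw : w ∈ semi α β) (hk : 0 ≤ k) :
    z + k * w ∈ semi α β := by
  obtain ⟨r, s, hr, hs, rfl⟩ := hz
  obtain ⟨r', s', hr', hs', rfl⟩ := hw
  exact ⟨r + k * r', s + k * s', by positivity, by positivity, by ring⟩

theorem notMem_semi_of_neg {α β z : ℤ} (hα : 0 < α) (hβ : 0 < β) (hz : z < 0) :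
    z ∉ semi α β := by
  rintro ⟨r, s, hr, hs, rfl⟩
  have := mul_nonneg hβ.le hr
  have := mul_nonneg hα.le hs
  omega

/-- The normal form of an integer with respect to two coprime generators. -/
theorem exists_normal_form {α β : ℤ} (hα : 0 < α) (h : IsCoprime α β) (z : ℤ) :
    ∃ r s : ℤ, 0 ≤ r ∧ r < α ∧ z = β * r + α * s := by
  obtain ⟨u, v, huv⟩ := h
  refine ⟨(z * v) % α, z * u + β * ((z * v) / α), Int.emod_nonneg _ hα.ne',
    Int.emod_lt_of_pos _ hα, ?_⟩
  have := Int.emod_add_mul_ediv (z * v) α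
  linear_combination -z * huv - β * this

/-- Two representations differ by a multiple of `α` in `r`; raising `s` to a nonnegative value would
lower `r` by at least `α`, below `0`. -/
theorem notMem_semi {α β r s : ℤ} (hα : 0 < α) (hβ : 0 < β) (h : IsCoprime α β) (hr : r < α)
    (hs : s < 0) : β * r + α * s ∉ semi α β := by
  rintro ⟨r', s', hr', hs', he⟩
  have h1 : β * (r - r') = α * (s' - s) := by linear_combination he
  have h2 : α ∣ r - r' := h.dvd_of_dvd_mul_left ⟨_, h1⟩
  have h3 : 0 < β * (r - r') := by rw [h1]; exact mul_pos hα (by omega)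
  have h4 : 0 < r - r' := pos_of_mul_pos_right h3 hβ.le
  have := Int.le_of_dvd h4 h2
  omega

theorem normal_form_unique {α β r s r' s' : ℤ} (hα : 0 < α) (h : IsCoprime α β)
    (hr : 0 ≤ r) (hr1 : r < α) (hr' : 0 ≤ r') (hr1' : r' < α)
    (he : β * r + α * s = β * r' + α * s') : r = r' ∧ s = s' := by
  have h2 : α ∣ r - r' := h.dvd_of_dvd_mul_left ⟨s' - s, by linear_combination he⟩
  have h3 : r - r' = 0 :=
    Int.eq_zero_of_abs_lt_dvd h2 (by rw [abs_lt]; constructor <;> omega)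
  have h4 : r = r' := by omega
  subst h4
  exact ⟨rfl, mul_left_cancel₀ hα.ne' (by linarith)⟩

theorem mem_semi_of_mul_le {α β z : ℤ} (hα : 0 < α) (hβ : 0 < β) (h : IsCoprime α β)
    (hz : α * β ≤ z) : z ∈ semi α β := by
  obtain ⟨r, s, hr, hr1, rfl⟩ := exists_normal_form hα h z
  refine ⟨r, s, hr, ?_, rfl⟩
  by_contra hs
  have h1 : β * r < β * α := mul_lt_mul_of_pos_left hr1 hβ
  have h2 : α * s < 0 := mul_neg_of_pos_of_neg hα (by omega)
  linarith

/-! ### Apéry sets -/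

/-- Every class modulo `p` contains an element of the Apéry set of the semigroup. -/
theorem exists_apery {p : ℕ} (hp : 0 < p) {α β : ℤ} (hα : 0 < α) (hβ : 0 < β)
    (h : IsCoprime α β) (t : ZMod p) :
    ∃ z ∈ semi α β, z - p ∉ semi α β ∧ (z : ZMod p) = t := by
  have : NeZero p := ⟨hp.ne'⟩
  have hex : ∃ k : ℕ, (t.val : ℤ) + k * p ∈ semi α β := by
    -- Every integer at least `α β` is in the semigroup, and `α β p ≥ α β`.
    refine ⟨(α * β).toNat, mem_semi_of_mul_le hα hβ h ?_⟩
    have h1 : ((α * β).toNat : ℤ) = α * β := Int.toNat_of_nonneg (by positivity)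
    rw [h1]
    have h2 : α * β * 1 ≤ α * β * p :=
      mul_le_mul_of_nonneg_left (by omega) (by positivity)
    omega
  obtain ⟨k, hk, hmin⟩ : ∃ k : ℕ, (t.val : ℤ) + k * p ∈ semi α β ∧
      ∀ j < k, (t.val : ℤ) + j * p ∉ semi α β := by
    classical
    exact ⟨Nat.find hex, Nat.find_spec hex, fun j hj => Nat.find_min hex hj⟩
  refine ⟨_, hk, ?_, by simp⟩
  rcases k with _ | k
  · apply notMem_semi_of_neg hα hβ
    have := ZMod.val_lt t
    push_cast
    omega
  · have h1 := hmin k (Nat.lt_succ_self k)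
    rwa [show (t.val : ℤ) + ((k + 1 : ℕ) : ℤ) * p - p = t.val + k * p by push_cast; ring]

theorem exists_mul_of_cast_eq {p : ℕ} {z w : ℤ} (h : (z : ZMod p) = w) :
    ∃ k : ℤ, z = w + k * p := by
  obtain ⟨k, hk⟩ := (ZMod.intCast_eq_intCast_iff_dvd_sub _ _ _).1 h
  exact ⟨-k, by linear_combination -hk⟩

/-- Minimality of Apéry elements: a smaller semigroup element `w` of the class would reach `z - p`
by adding copies of `p`. -/
theorem mem_semi_of_cast_eq {p : ℕ} {α β z w : ℤ} (hpG : (p : ℤ) ∈ semi α β)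
    (hw : w ∈ semi α β) (hz : z - p ∉ semi α β) (he : (w : ZMod p) = z) :
    ∃ k : ℤ, 0 ≤ k ∧ w = z + k * p := by
  obtain ⟨k, hk⟩ := exists_mul_of_cast_eq he
  refine ⟨k, ?_, hk⟩
  by_contra hk0
  apply hz
  have := semi_add_mul hw hpG (k := -k - 1) (by omega)
  convert this using 1
  rw [hk]; ring

theorem apery_unique {p : ℕ} (hp : 0 < p) {α β z w : ℤ} (hpG : (p : ℤ) ∈ semi α β)
    (hz : z ∈ semi α β) (hz' : z - p ∉ semi α β) (hw : w ∈ semi α β)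
    (hw' : w - p ∉ semi α β) (he : (w : ZMod p) = z) : w = z := by
  obtain ⟨k, hk, h1⟩ := mem_semi_of_cast_eq hpG hw hz' he
  obtain ⟨l, hl, h2⟩ := mem_semi_of_cast_eq hpG hz hw' he.symm
  have h3 : 0 ≤ k * p := by positivity
  have h4 : 0 ≤ l * p := by positivity
  omega

/-! ### Counting the missed residues -/

/-- If `α h - p` lies in the semigroup, the rectangle of height `h` covers all residues. -/
theorem missed_eq_empty {p : ℕ} (hp : 0 < p) {α β h : ℤ} (hα : 0 < α) (hβ : 0 < β)
    (hαβ : IsCoprime α β) (hh : α * h - p ∈ semi α β) : missed p α β h = ∅ := by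
  rw [Set.eq_empty_iff_forall_notMem]
  intro t ht
  obtain ⟨z, hz, hz', rfl⟩ := exists_apery hp hα hβ hαβ t
  obtain ⟨r, s, hr, hr1, rfl⟩ := exists_normal_form hα hαβ z
  have hs : 0 ≤ s := by
    by_contra hs
    exact notMem_semi hα hβ hαβ hr1 (by omega) hz
  by_cases hs' : s < h
  · exact ht r s hr hr1 hs hs' rfl
  · apply hz'
    have h1 : β * r + α * (s - h) ∈ semi α β := ⟨r, s - h, hr, by omega, rfl⟩
    convert semi_add h1 hh using 1
    ring

/-- The Apéry set of `p = β y + α X` in normal form is an L-shaped region. -/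
theorem notMem_semi_sub {p : ℕ} {α β X y r s : ℤ} (hα : 0 < α) (hβ : 0 < β)
    (hαβ : IsCoprime α β) (hy : 0 < y) (hpe : (p : ℤ) = β * y + α * X) (hr1 : r < α)
    (hL : s < X ∨ r < y ∧ s < X + β) : β * r + α * s - p ∉ semi α β := by
  rcases hL with hs | ⟨hr, hs⟩
  · have := notMem_semi (s := s - X) hα hβ hαβ (show r - y < α by omega) (by omega)
    convert this using 2
    rw [hpe]; ring
  · have := notMem_semi (s := s - X - β) hα hβ hαβ (show r - y + α < α by omega) (by omega)
    convert this using 2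
    rw [hpe]; ring

theorem exists_apery_normal_form {p : ℕ} (hp : 0 < p) {α β X y : ℤ} (hα : 0 < α) (hβ : 0 < β)
    (hαβ : IsCoprime α β) (hyα : y ≤ α) (hpe : (p : ℤ) = β * y + α * X) (t : ZMod p) :
    ∃ r s : ℤ, 0 ≤ r ∧ r < α ∧ 0 ≤ s ∧ (s < X ∨ r < y ∧ s < X + β) ∧
      ((β * r + α * s : ℤ) : ZMod p) = t := by
  obtain ⟨z, hz, hz', rfl⟩ := exists_apery hp hα hβ hαβ t
  obtain ⟨r, s, hr, hr1, rfl⟩ := exists_normal_form hα hαβ z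
  have hs : 0 ≤ s := by
    by_contra hs
    exact notMem_semi hα hβ hαβ hr1 (by omega) hz
  refine ⟨r, s, hr, hr1, hs, ?_, rfl⟩
  by_contra hL
  push Not at hL
  apply hz'
  -- Subtracting `p` shifts `(r, s)` by `(-y, -X)`; if `r < y`, the first coordinate is renormalised
  -- by `(α, -β)`.
  by_cases hry : r < y
  · exact ⟨r - y + α, s - X - β, by omega, by have := hL.2 hry; omega, by rw [hpe]; ring⟩
  · exact ⟨r - y, s - X, by omega, by have := hL.1; omega, by rw [hpe]; ring⟩

/-- The cut is at or above the inner corner of the L, so the part above it is a `y × x` rectangle.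
-/
theorem ncard_missed_of_le {p : ℕ} (hp : 0 < p) {α β X x y : ℤ} (hα : 0 < α) (hβ : 0 < β)
    (hαβ : IsCoprime α β) (hX : 0 ≤ X) (hx : 0 < x) (hy : 0 < y) (hyα : y ≤ α) (hxβ : x ≤ β)
    (hpe : (p : ℤ) = β * y + α * X) :
    ((missed p α β (X + β - x)).ncard : ℤ) = x * y := by
  have hpG : (p : ℤ) ∈ semi α β := ⟨y, X, hy.le, hX, hpe⟩
  let f : ℤ × ℤ → ZMod p := fun a => ((β * a.1 + α * (X + β - x + a.2) : ℤ) : ZMod p)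
  have himg : missed p α β (X + β - x) =
      f '' ((Finset.Ico (0 : ℤ) y ×ˢ Finset.Ico (0 : ℤ) x : Finset (ℤ × ℤ)) : Set (ℤ × ℤ)) := by
    ext t
    constructor
    · intro ht
      obtain ⟨r, s, hr, hr1, hs, hL, rfl⟩ := exists_apery_normal_form hp hα hβ hαβ hyα hpe t
      have h1 : X + β - x ≤ s := by
        by_contra h1
        exact ht r s hr hr1 hs (by omega) rfl
      refine ⟨(r, s - (X + β - x)), ?_, ?_⟩
      · simp only [Finset.coe_product, Finset.coe_Ico, Set.mem_prod, Set.mem_Ico]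
        omega
      · simp only [f]
        congr 1
        ring
    · rintro ⟨⟨r, s⟩, hrs, rfl⟩ r' s' hr' hr1' hs' hs1' he
      simp only [Finset.coe_product, Finset.coe_Ico, Set.mem_prod, Set.mem_Ico] at hrs
      obtain ⟨k, hk, h1⟩ := mem_semi_of_cast_eq hpG ⟨r', s', hr', hs', rfl⟩
        (notMem_semi_sub (r := r) (s := X + β - x + s) hα hβ hαβ hy hpe (by omega)
          (Or.inr (by omega))) he
      -- A rectangle value in this class exceeds the Apéry element by `k p`. Lowering both by `α (X
      -- + β - x)` gives a semigroup element whose normal form has a negative coefficient of `α`.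
      have h2 : β * r + α * s ∈ semi α β := ⟨r, s, by omega, by omega, rfl⟩
      have h3 := semi_add_mul h2 hpG hk
      have h4 := notMem_semi (s := s' - (X + β - x)) hα hβ hαβ hr1' (by omega)
      apply h4
      convert h3 using 1
      linear_combination h1
  rw [himg, Set.InjOn.ncard_image, Set.ncard_coe_finset, Finset.card_product, Int.card_Ico,
    Int.card_Ico]
  · push_cast
    rw [Int.toNat_of_nonneg (by omega), Int.toNat_of_nonneg (by omega)]
    ring
  · rintro ⟨r, s⟩ hrs ⟨r', s'⟩ hrs' he
    simp only [Finset.coe_product, Finset.coe_Ico, Set.mem_prod, Set.mem_Ico] at hrs hrs'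
    have h1 := apery_unique hp hpG
      ⟨r', X + β - x + s', by omega, by omega, rfl⟩
      (notMem_semi_sub (r := r') hα hβ hαβ hy hpe (by omega) (Or.inr (by omega)))
      ⟨r, X + β - x + s, by omega, by omega, rfl⟩
      (notMem_semi_sub (r := r) hα hβ hαβ hy hpe (by omega) (Or.inr (by omega))) he
    have := normal_form_unique hα hαβ (by omega) (by omega) (by omega) (by omega) h1
    ext <;> simp <;> omega

/-- The rectangle stays within the rows `s < X` of the L, so its `α h` values are distinct modulo
`p`. -/
theorem ncard_missed_of_lt {p : ℕ} (hp : 0 < p) {α β X y h : ℤ} (hα : 0 < α) (hβ : 0 < β)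
    (hαβ : IsCoprime α β) (hh : 0 ≤ h) (hhX : h ≤ X) (hy : 0 < y)
    (hpe : (p : ℤ) = β * y + α * X) :
    ((missed p α β h).ncard : ℤ) = p - α * h := by
  have : NeZero p := ⟨hp.ne'⟩
  have hpG : (p : ℤ) ∈ semi α β := ⟨y, X, hy.le, by omega, hpe⟩
  let f : ℤ × ℤ → ZMod p := fun a => ((β * a.1 + α * a.2 : ℤ) : ZMod p)
  have himg : missed p α β h =
      (f '' ((Finset.Ico (0 : ℤ) α ×ˢ Finset.Ico (0 : ℤ) h : Finset (ℤ × ℤ)) : Set (ℤ × ℤ)))ᶜ := by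
    ext t
    simp only [missed, Set.mem_ofPred_eq, Set.mem_compl_iff, Set.mem_image, not_exists, not_and,
      Prod.forall, Finset.coe_product, Finset.coe_Ico, Set.mem_prod, Set.mem_Ico, f]
    exact ⟨fun H r s hrs => H r s hrs.1.1 hrs.1.2 hrs.2.1 hrs.2.2,
      fun H r s h1 h2 h3 h4 => H r s ⟨⟨h1, h2⟩, h3, h4⟩⟩
  have hinj : Set.InjOn f
      ((Finset.Ico (0 : ℤ) α ×ˢ Finset.Ico (0 : ℤ) h : Finset (ℤ × ℤ)) : Set (ℤ × ℤ)) := by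
    rintro ⟨r, s⟩ hrs ⟨r', s'⟩ hrs' he
    simp only [Finset.coe_product, Finset.coe_Ico, Set.mem_prod, Set.mem_Ico] at hrs hrs'
    have h1 := apery_unique hp hpG
      ⟨r', s', by omega, by omega, rfl⟩
      (notMem_semi_sub (r := r') hα hβ hαβ hy hpe (by omega) (Or.inl (by omega)))
      ⟨r, s, by omega, by omega, rfl⟩
      (notMem_semi_sub (r := r) hα hβ hαβ hy hpe (by omega) (Or.inl (by omega))) he
    have := normal_form_unique hα hαβ (by omega) (by omega) (by omega) (by omega) h1
    ext <;> simp <;> omega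
  have hc := Set.ncard_add_ncard_compl (f ''
    ((Finset.Ico (0 : ℤ) α ×ˢ Finset.Ico (0 : ℤ) h : Finset (ℤ × ℤ)) : Set (ℤ × ℤ)))
  rw [← himg, hinj.ncard_image, Set.ncard_coe_finset, Finset.card_product,
    Int.card_Ico, Int.card_Ico, Nat.card_zmod] at hc
  have hc' := congrArg (Nat.cast : ℕ → ℤ) hc
  push_cast at hc'
  rw [Int.toNat_of_nonneg (by omega), Int.toNat_of_nonneg (by omega)] at hc'
  linear_combination hc'


/-! ### Letter positions in Christoffel words -/

theorem C_of_coprime {A : Type*} (c z : A) {n a : ℕ} (ha : a ≤ n) (h : n.Coprime a) :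
    C c z n a = (List.range n).map fun i =>
      if n - a = 0 ∨ (i * (n - a)) % n < ((i + 1) * (n - a)) % n then c else z := by
  unfold C christoffelWord
  rw [Nat.Coprime.gcd_eq_one h]
  simp [Nat.add_sub_cancel' ha]

theorem length_C {A : Type*} (c z : A) {n a : ℕ} (ha : a ≤ n) (h : n.Coprime a) :
    (C c z n a).length = n := by
  rw [C_of_coprime c z ha h]; simp

/-- Adding `n - a` to a remainder `v` increases it exactly when there is no wrap-around, i.e. `v <
a`. -/
theorem mod_lt_succ_mod_iff {n a i : ℕ} (hn : 0 < n) (ha : a ≤ n) :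
    (n - a = 0 ∨ (i * (n - a)) % n < ((i + 1) * (n - a)) % n) ↔ (i * (n - a)) % n < a := by
  rw [Nat.add_one_mul]
  generalize i * (n - a) = w
  have hw := Nat.mod_lt w hn
  rcases Nat.eq_zero_or_pos (n - a) with h0 | h0
  · simp only [h0, true_or, true_iff]; omega
  rw [Nat.add_mod]
  rcases Nat.eq_zero_or_pos a with rfl | ha0
  · simp; omega
  rw [Nat.mod_eq_of_lt (show n - a < n by omega)]
  generalize w % n = v at hw ⊢
  by_cases hlt : v + (n - a) < n
  · rw [Nat.mod_eq_of_lt hlt]; omega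
  · rw [Nat.mod_eq_sub_mod (by omega), Nat.mod_eq_of_lt (by omega)]; omega

theorem mem_periodicPositions {A : Type*} {c : A} {u : List A} {j : ℤ} :
    j ∈ periodicPositions c u ↔ u[(j % u.length).toNat]? = some c := by
  constructor
  · rintro ⟨i, t, hi, rfl⟩
    obtain ⟨hlt, -⟩ := List.getElem?_eq_some_iff.1 hi
    rw [Int.add_mul_emod_self_left, Int.emod_eq_of_lt (by omega) (by omega)]
    simpa using hi
  · intro h
    obtain ⟨hlt, -⟩ := List.getElem?_eq_some_iff.1 h
    refine ⟨_, j / u.length, h, ?_⟩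
    rw [Int.toNat_of_nonneg (Int.emod_nonneg _ (by omega))]
    exact (Int.emod_add_mul_ediv j u.length).symm

theorem mem_periodicPositions_rotate {A : Type*} {c : A} {u : List A} (k : ℕ) {j : ℤ} :
    j ∈ periodicPositions c (u.rotate k) ↔ j + k ∈ periodicPositions c u := by
  rw [mem_periodicPositions, mem_periodicPositions, List.length_rotate]
  rcases Nat.eq_zero_or_pos u.length with h0 | h0
  · rw [List.length_eq_zero_iff] at h0
    simp [h0]
  have h1 := Int.emod_nonneg j (show (u.length : ℤ) ≠ 0 by omega)
  have h2 := Int.emod_lt_of_pos j (show 0 < (u.length : ℤ) by omega)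
  rw [List.getElem?_rotate (by omega)]
  suffices ((j % u.length).toNat + k) % u.length = ((j + k) % u.length).toNat by rw [this]
  zify
  rw [Int.toNat_of_nonneg h1, Int.toNat_of_nonneg (Int.emod_nonneg _ (by omega)),
    Int.emod_add_emod]

theorem mem_periodicPositions_C {A : Type*} {c z : A} (hcz : c ≠ z) {n a : ℕ} (hn : 0 < n)
    (ha : a ≤ n) (h : n.Coprime a) {j : ℤ} :
    j ∈ periodicPositions c (C c z n a) ↔ ∃ r : ℤ, 0 ≤ r ∧ r < a ∧ (n : ℤ) ∣ j * a + r := by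
  have hj := Int.emod_nonneg j (show (n : ℤ) ≠ 0 by omega)
  have hj' := Int.emod_lt_of_pos j (show 0 < (n : ℤ) by omega)
  obtain ⟨i, hi⟩ := Int.eq_ofNat_of_zero_le hj
  have key : j ∈ periodicPositions c (C c z n a) ↔ (i * (n - a)) % n < a := by
    rw [mem_periodicPositions, length_C c z ha h, hi, C_of_coprime c z ha h, Int.toNat_natCast,
      List.getElem?_map, List.getElem?_range (by omega), Option.map_some, Option.some_inj,
      ← mod_lt_succ_mod_iff hn ha]
    split_ifs with h1
    · simpa using h1
    · simpa [hcz.symm] using h1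
  have hcong : ((i * (n - a) : ℕ) : ℤ) ≡ -(j * a) [ZMOD n] := by
    rw [Int.modEq_iff_dvd]
    obtain ⟨t, ht⟩ := Int.dvd_sub_self_of_emod_eq hi
    refine ⟨-i + t * a, ?_⟩
    push_cast [Nat.cast_sub ha]
    linear_combination a * ht
  rw [key]
  constructor
  · intro hlt
    refine ⟨((i * (n - a)) % n : ℕ), by omega, by omega, ?_⟩
    have h1 : (((i * (n - a)) % n : ℕ) : ℤ) ≡ -(j * a) [ZMOD n] := by
      rw [Int.natCast_mod]; exact (Int.mod_modEq _ _).trans hcong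
    obtain ⟨t, ht⟩ := Int.modEq_iff_dvd.1 h1.symm
    exact ⟨t, by linear_combination ht⟩
  · rintro ⟨r, hr, hra, hd⟩
    have h1 : r ≡ ((i * (n - a) : ℕ) : ℤ) [ZMOD n] := by
      refine Int.ModEq.trans ?_ hcong.symm
      rw [Int.modEq_iff_dvd]
      obtain ⟨t, ht⟩ := hd
      exact ⟨-t, by linear_combination -ht⟩
    have h2 : (((i * (n - a)) % n : ℕ) : ℤ) = r := by
      rw [Int.natCast_mod, ← h1, Int.emod_eq_of_lt hr (by omega)]
    omega


/-! ### From shifts to missed residues -/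

theorem exists_rect_iff {q α β z : ℤ} (hq : 0 < q) (hα : 0 < α) (hβ : 0 < β) :
    (∃ r s : ℤ, 0 ≤ r ∧ r < q * α ∧ 0 ≤ s ∧ s < q * β ∧ z = β * r + α * s) ↔
      ∃ r s : ℤ, 0 ≤ r ∧ r < α ∧ 0 ≤ s ∧ s < (2 * q - 1) * β ∧ z = β * r + α * s := by
  constructor
  · rintro ⟨r, s, hr, hr1, hs, hs1, rfl⟩
    have h1 := Int.emod_add_mul_ediv r α
    have h2 : r / α < q := Int.ediv_lt_of_lt_mul hα hr1
    have h3 : 0 ≤ r / α := Int.ediv_nonneg hr hα.le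
    refine ⟨r % α, s + r / α * β, Int.emod_nonneg _ hα.ne', Int.emod_lt_of_pos _ hα, by positivity,
      ?_, by linear_combination -β * h1⟩
    have h4 : r / α * β ≤ (q - 1) * β := mul_le_mul_of_nonneg_right (by omega) hβ.le
    linarith
  · rintro ⟨r, s, hr, hr1, hs, hs1, rfl⟩
    by_cases hsq : s < q * β
    · exact ⟨r, s, hr, by nlinarith, hs, hsq, rfl⟩
    · have h1 : 0 ≤ (q - 1) * α := mul_nonneg (by omega) hα.le
      exact ⟨r + (q - 1) * α, s - (q - 1) * β, by omega, by linarith, by linarith, by linarith,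
        by ring⟩

theorem exists_dvd_mul_add {n a : ℤ} (h : IsCoprime n a) (r : ℤ) : ∃ i : ℤ, n ∣ i * a + r := by
  obtain ⟨u, v, huv⟩ := h
  exact ⟨-v * r, u * r, by linear_combination -r * huv⟩

/-- The letters `a` of `C(n, q α)` and the letters `b` of `C(m, q β)` shifted by `k` meet only if
an associated residue modulo `gcd(m, n)` is attained on a rectangle. -/
theorem exists_common_position_iff {n m q α β : ℕ} (hq : 0 < q) (hα : 0 < α)
    (hβ : 0 < β) (hn : n.Coprime (q * α)) (hm : m.Coprime (q * β)) (k : ℤ) :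
    (∃ i : ℤ, (∃ r : ℤ, 0 ≤ r ∧ r < (q * α : ℕ) ∧ (n : ℤ) ∣ i * (q * α : ℕ) + r) ∧
      ∃ s : ℤ, 0 ≤ s ∧ s < (q * β : ℕ) ∧ (m : ℤ) ∣ (i + k) * (q * β : ℕ) + s) ↔
    (((q * α * β : ℤ) * k + (q * β - 1) * α : ℤ) : ZMod (m.gcd n)) ∉
      missed (m.gcd n) α β ((2 * q - 1) * β) := by
  have hpn : ((m.gcd n : ℕ) : ℤ) ∣ n := by exact_mod_cast Nat.gcd_dvd_right m n
  have hpm : ((m.gcd n : ℕ) : ℤ) ∣ m := by exact_mod_cast Nat.gcd_dvd_left m n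
  have hmissed : (((q * α * β : ℤ) * k + (q * β - 1) * α : ℤ) : ZMod (m.gcd n)) ∉
      missed (m.gcd n) α β ((2 * q - 1) * β) ↔ ∃ z : ℤ,
        ((z : ℤ) : ZMod (m.gcd n)) = ((q * α * β : ℤ) * k + (q * β - 1) * α : ℤ) ∧
        ∃ r s : ℤ, 0 ≤ r ∧ r < q * α ∧ 0 ≤ s ∧ s < q * β ∧ z = β * r + α * s := by
    simp_rw [exists_rect_iff (show (0 : ℤ) < q by omega) (show (0 : ℤ) < α by omega)
      (show (0 : ℤ) < β by omega)]
    simp only [missed, Set.mem_ofPred_eq]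
    push Not
    constructor
    · rintro ⟨r, s, h1, h2, h3, h4, h5⟩
      exact ⟨_, h5, r, s, h1, h2, h3, h4, rfl⟩
    · rintro ⟨_, h5, r, s, h1, h2, h3, h4, rfl⟩
      exact ⟨r, s, h1, h2, h3, h4, h5⟩
  rw [hmissed]
  simp only [Nat.cast_mul]
  constructor
  · rintro ⟨i, ⟨r, hr, hr1, hrd⟩, s, hs, hs1, hsd⟩
    -- The reflection `s ↦ q β - 1 - s` turns the difference `β r - α s ≡ q α β k` into a sum.
    refine ⟨β * r + α * (q * β - 1 - s), ?_, r, q * β - 1 - s, hr, hr1, by omega, by omega, rfl⟩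
    rw [ZMod.intCast_eq_intCast_iff_dvd_sub]
    obtain ⟨e, he⟩ := hpn.trans hrd
    obtain ⟨f, hf⟩ := hpm.trans hsd
    exact ⟨α * f - β * e, by linear_combination α * hf - β * he⟩
  · rintro ⟨z, hz, r, s, hr, hr1, hs, hs1, rfl⟩
    obtain ⟨i, hi⟩ := exists_dvd_mul_add (Nat.isCoprime_iff_coprime.2 hn) r
    obtain ⟨j, hj⟩ := exists_dvd_mul_add (Nat.isCoprime_iff_coprime.2 hm) (q * β - 1 - s)
    push_cast at hi hj
    have hd : ((m.gcd n : ℕ) : ℤ) ∣ (j - i - k) * (q * α * (q * β)) := by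
      obtain ⟨d, hd⟩ := (ZMod.intCast_eq_intCast_iff_dvd_sub _ _ _).1 hz
      obtain ⟨e, he⟩ := hpn.trans hi
      obtain ⟨f, hf⟩ := hpm.trans hj
      exact ⟨q * (α * f - β * e - d), by linear_combination q * (α * hf - β * he - hd)⟩
    have hc : IsCoprime ((m.gcd n : ℕ) : ℤ) (q * α * (q * β)) := by
      refine IsCoprime.mul_right ?_ ?_
      · exact (by exact_mod_cast Nat.isCoprime_iff_coprime.2 hn :
          IsCoprime (n : ℤ) (q * α)).of_isCoprime_of_dvd_left hpn
      · exact (by exact_mod_cast Nat.isCoprime_iff_coprime.2 hm :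
          IsCoprime (m : ℤ) (q * β)).of_isCoprime_of_dvd_left hpm
    obtain ⟨d, hd⟩ := hc.dvd_of_dvd_mul_right hd
    have hb := Nat.gcd_eq_gcd_ab m n
    -- Bézout gluing: since `j - i - k = p d` and `p = m A + n B`, the position `i + n B d` equals
    -- `j - k - m A d`, hence is `i` modulo `n` and `j - k` modulo `m`.
    refine ⟨i + n * (m.gcdB n * d), ⟨r, hr, hr1, ?_⟩, q * β - 1 - s, by omega, by omega, ?_⟩
    · obtain ⟨e, he⟩ := hi
      exact ⟨e + m.gcdB n * d * (q * α), by linear_combination he⟩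
    · obtain ⟨f, hf⟩ := hj
      exact ⟨f - m.gcdA n * d * (q * β), by
        linear_combination hf - q * β * hd - q * β * d * hb⟩

/-- Each of the `d` blocks of `p` consecutive `k` is mapped bijectively onto the residues, so `k` is
encoded by its residue and its block `k / p`. -/
theorem ncard_affine_mem {p d : ℕ} (hp : 0 < p) {e : ZMod p} (he : IsUnit e) (c : ZMod p)
    (M : Set (ZMod p)) :
    {k : ℕ | k < p * d ∧ e * k + c ∈ M}.ncard = M.ncard * d := by
  have : NeZero p := ⟨hp.ne'⟩
  have hinj : Set.InjOn (fun k : ℕ => ((e * k + c : ZMod p), k / p))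
      {k : ℕ | k < p * d ∧ e * k + c ∈ M} := by
    intro k _ l _ h
    simp only [Prod.mk.injEq, add_left_inj] at h
    have h1 := (ZMod.natCast_eq_natCast_iff' _ _ _).1 (he.mul_left_cancel h.1)
    rw [← Nat.mod_add_div k p, ← Nat.mod_add_div l p, h1, h.2]
  suffices h : (fun k : ℕ => ((e * k + c : ZMod p), k / p)) ''
      {k : ℕ | k < p * d ∧ e * k + c ∈ M} = M ×ˢ Set.Iio d by
    rw [← hinj.ncard_image, h, Set.ncard_prod, Set.ncard_Iio_nat]
  ext ⟨t, j⟩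
  simp only [Set.mem_image, Set.mem_ofPred_eq, Prod.mk.injEq, Set.mem_prod, Set.mem_Iio]
  constructor
  · rintro ⟨k, ⟨hk, hM⟩, rfl, rfl⟩
    exact ⟨hM, Nat.div_lt_of_lt_mul hk⟩
  · rintro ⟨ht, hj⟩
    obtain ⟨w, hw⟩ := he.exists_right_inv
    have hv := ZMod.val_lt (w * (t - c))
    have h1 : e * (((w * (t - c)).val + p * j : ℕ) : ZMod p) + c = t := by
      push_cast
      rw [ZMod.natCast_zmod_val, ZMod.natCast_self]
      linear_combination (t - c) * hw
    refine ⟨(w * (t - c)).val + p * j, ⟨?_, by rwa [h1]⟩, h1, ?_⟩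
    · calc _ < p * (j + 1) := by rw [mul_add]; omega
        _ ≤ p * d := Nat.mul_le_mul_left _ hj
    · rw [Nat.add_mul_div_left _ _ hp, Nat.div_eq_of_lt hv, zero_add]

theorem numSuperimpositions_C {n m q α β : ℕ} (hq : 0 < q) (hα : 0 < α) (hβ : 0 < β)
    (hnα : q * α ≤ n) (hmβ : q * β ≤ m) (hn : n.Coprime (q * α)) (hm : m.Coprime (q * β)) :
    numSuperimpositions (C Letter.a Letter.x n (q * α)) (C Letter.b Letter.x m (q * β)) =
      (missed (m.gcd n) α β ((2 * q - 1) * β)).ncard * (m / m.gcd n) := by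
  have hn0 : 0 < n := lt_of_lt_of_le (Nat.mul_pos hq hα) hnα
  have hm0 : 0 < m := lt_of_lt_of_le (Nat.mul_pos hq hβ) hmβ
  have hp : 0 < m.gcd n := Nat.gcd_pos_of_pos_left n hm0
  have hpn := Nat.gcd_dvd_right m n
  have hpm := Nat.gcd_dvd_left m n
  have hu : IsUnit ((q * α * β : ℕ) : ZMod (m.gcd n)) := by
    rw [ZMod.isUnit_iff_coprime, Nat.coprime_comm]
    exact (hn.coprime_dvd_left hpn).mul_right
      ((hm.coprime_dvd_left hpm).coprime_dvd_right (Dvd.intro_left _ rfl))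
  rw [← ncard_affine_mem hp hu (((q * β - 1) * α : ℤ) : ZMod (m.gcd n)), Nat.mul_div_cancel' hpm]
  unfold numSuperimpositions
  rw [length_C _ _ hmβ hm]
  congr 1
  ext k
  refine and_congr_right fun _ => ?_
  have h1 := exists_common_position_iff hq hα hβ hn hm k
  have h2 : (((q * α * β : ℤ) * (k : ℤ) + (q * β - 1) * α : ℤ) : ZMod (m.gcd n)) =
      ((q * α * β : ℕ) : ZMod (m.gcd n)) * k + (((q * β - 1) * α : ℤ) : ZMod (m.gcd n)) := by
    push_cast; ring
  rw [← h2, ← not_iff_not, ← h1, PerfectlySuperimposable, ← Set.not_nonempty_iff_eq_empty, not_not]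
  refine exists_congr fun i => ?_
  rw [Set.mem_inter_iff, mem_periodicPositions_rotate,
    mem_periodicPositions_C (by simp) hn0 hnα hn, mem_periodicPositions_C (by simp) hm0 hmβ hm]

theorem missed_nonempty {n m q α β : ℕ} (hq : 0 < q) (hα : 0 < α) (hβ : 0 < β)
    (hnα : q * α ≤ n) (hmβ : q * β ≤ m) (hn : n.Coprime (q * α)) (hm : m.Coprime (q * β))
    (h : Superimposable (C Letter.a Letter.x n (q * α)) (C Letter.b Letter.x m (q * β))) :
    (missed (m.gcd n) α β ((2 * q - 1) * β)).Nonempty := by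
  have hn0 : 0 < n := lt_of_lt_of_le (Nat.mul_pos hq hα) hnα
  have hm0 : 0 < m := lt_of_lt_of_le (Nat.mul_pos hq hβ) hmβ
  obtain ⟨k, hk⟩ := h
  by_contra hne
  obtain ⟨i, hi, hi'⟩ := (exists_common_position_iff hq hα hβ hn hm k).2
    fun h => hne ⟨_, h⟩
  rw [← mem_periodicPositions_C (show Letter.a ≠ Letter.x by simp) hn0 hnα hn] at hi
  rw [← mem_periodicPositions_C (show Letter.b ≠ Letter.x by simp) hm0 hmβ hm] at hi'
  exact Set.eq_empty_iff_forall_notMem.1 hk i ⟨hi, i + k, hi', by ring⟩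

/-- Solutions of `x α + y β = T` with `y` in a fixed complete system of residues modulo `α`. -/
theorem exists_solution {α β : ℤ} (hα : 0 < α) (h : IsCoprime α β) (T : ℤ) :
    ∃ x y : ℤ, 0 < y ∧ y ≤ α ∧ x * α + y * β = T := by
  obtain ⟨r, s, hr, hr1, he⟩ := exists_normal_form hα h (T - β)
  exact ⟨s, r + 1, by omega, by omega, by linear_combination -he⟩

end Christoffel

theorem proposition4p3 (n m q α β : ℕ)
    (hq : 0 < q) (hα : 0 < α) (hβ : 0 < β) (hαβ : Nat.Coprime α β)
    (hnα : q * α ≤ n) (hmβ : q * β ≤ m)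
    (hn : Nat.Coprime n (q * α)) (hm : Nat.Coprime m (q * β))
    (hnm : n < m)
    (hsup : Christoffel.Superimposable
      (Christoffel.C Christoffel.Letter.a Christoffel.Letter.x n (q * α))
      (Christoffel.C Christoffel.Letter.b Christoffel.Letter.x m (q * β))) :
    (∃! s : ℕ × ℕ, 0 < s.1 ∧ 0 < s.2 ∧ s.2 ≤ α ∧
      (s.1 : ℤ) * α + (s.2 : ℤ) * β = (Nat.gcd m n : ℤ) - 2 * α * β * ((q : ℤ) - 1)) ∧
    ∀ x y : ℕ, 0 < x → 0 < y → y ≤ α →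
      (x : ℤ) * α + (y : ℤ) * β = (Nat.gcd m n : ℤ) - 2 * α * β * ((q : ℤ) - 1) →
      (x ≤ β →
        Christoffel.numSuperimpositions
          (Christoffel.C Christoffel.Letter.a Christoffel.Letter.x n (q * α))
          (Christoffel.C Christoffel.Letter.b Christoffel.Letter.x m (q * β))
            = x * y * (m / Nat.gcd m n)) ∧
      (β < x →
        (Christoffel.numSuperimpositions
          (Christoffel.C Christoffel.Letter.a Christoffel.Letter.x n (q * α))
          (Christoffel.C Christoffel.Letter.b Christoffel.Letter.x m (q * β)) : ℤ)
            = ((x : ℤ) * α + (y : ℤ) * β - (α : ℤ) * β) * ((m / Nat.gcd m n : ℕ) : ℤ)) := by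
  have hm0 : 0 < m := by omega
  have hp : 0 < m.gcd n := Nat.gcd_pos_of_pos_left n hm0
  have hαZ : (0 : ℤ) < α := by omega
  have hβZ : (0 : ℤ) < β := by omega
  have hc : IsCoprime (α : ℤ) β := Nat.isCoprime_iff_coprime.2 hαβ
  have hne := Christoffel.missed_nonempty hq hα hβ hnα hmβ hn hm hsup
  have hq' : (0 : ℤ) ≤ (q - 1) * β := mul_nonneg (by omega) (by omega)
  refine ⟨?_, ?_⟩
  · obtain ⟨x, y, hy, hyα, he⟩ := Christoffel.exists_solution hαZ hc
      ((m.gcd n : ℤ) - 2 * α * β * ((q : ℤ) - 1))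
    have hx : 0 < x := by
      by_contra hx
      -- With `h = (2q - 1) β`, `α h - p = β (α - y) + α (-x)`; if `x ≤ 0` this is in the semigroup
      -- and no shift would work.
      rw [Christoffel.missed_eq_empty hp hαZ hβZ hc
        ⟨α - y, -x, by omega, by omega, by linear_combination he⟩] at hne
      exact Set.not_nonempty_empty hne
    lift x to ℕ using hx.le
    lift y to ℕ using hy.le
    refine ⟨(x, y), ⟨by omega, by omega, by omega, he⟩, ?_⟩
    rintro ⟨x', y'⟩ ⟨-, hy', hyα', he'⟩
    dsimp only at hy' hyα' he'
    -- Passing to `y - 1` moves the range `1, …, α` to the normal-form range `0, …, α - 1`.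
    have := Christoffel.normal_form_unique (r := (y : ℤ) - 1) (r' := (y' : ℤ) - 1) (s := x)
      (s' := x') hαZ hc (by omega) (by omega) (by omega) (by omega)
      (by linear_combination he - he')
    ext <;> dsimp only <;> omega
  · intro x y hx hy hyα he
    rw [Christoffel.numSuperimpositions_C hq hα hβ hnα hmβ hn hm]
    have hpe : ((m.gcd n : ℕ) : ℤ) = β * y + α * (x + 2 * ((q - 1) * β)) := by
      linear_combination -he
    refine ⟨fun hxβ => ?_, fun hxβ => ?_⟩
    · have h1 := Christoffel.ncard_missed_of_le hp hαZ hβZ hc (x := x) (by omega) (by omega)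
        (by omega) (by omega) (by omega) hpe
      rw [show (x : ℤ) + 2 * ((q - 1) * β) + β - x = (2 * q - 1) * β by ring] at h1
      rw [show (Christoffel.missed (m.gcd n) α β ((2 * q - 1) * β)).ncard = x * y by
        exact_mod_cast h1]
    · have h1 := Christoffel.ncard_missed_of_lt (h := (2 * q - 1) * β) hp hαZ hβZ hc
        (by linarith) (by linarith) (by omega) hpe
      push_cast
      rw [h1, he]
      ring
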